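/- Let $D$ be a division ring (not necessarily commutative). Call a division ring centrally finite if it is a finite-dimensional vector space over its center, and assume that $D$ is weakly locally finite, that is, for every finite subset $S \subseteq D$ the division subring of $D$ generated by $S$ is centrally finite (over its own center). Let $N$ be a subgroup of the multiplicative group $D^* = D \setminus \{0\}$ which is finitely generated as a group and subnormal in $D^*$, that is, there is a finite chain of subgroups $N = N_1 \trianglelefteq N_2 \trianglelefteq \cdots \trianglelefteq N_r = D^*$, each normal in the next. Then $N$ is central, that is, $N$ is contained in the center of $D$. -/

import Mathlib

/-- A division ring `D` is *centrally finite* if it is a finite-dimensional vector space over its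
center. -/
def IsCentrallyFinite (D : Type*) [DivisionRing D] : Prop :=
  Module.Finite (Subring.center D) D

/-- A division ring `D` is *weakly locally finite* if, for every finite subset `S` of `D`, the
division subring of `D` generated by `S` is centrally finite (over its own center).
`Subfield D`, for a not necessarily commutative division ring `D`, is Mathlib's type of division
subrings of `D`; `Subfield.closure S` is the smallest one that contains `S`. -/
def IsWeaklyLocallyFinite (D : Type*) [DivisionRing D] : Prop :=
  ∀ S : Set D, S.Finite → IsCentrallyFinite (Subfield.closure S)

/-! If some `x ∈ N` is noncentral, then generators of `N`, `x` and an element not commuting with `x`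
generate a division subring `K` that is finite-dimensional over its center `F`. Subnormality gives a
single large `n` such that the iterated conjugate `cₙ`, where `cₙ₊₁ = cₙ x cₙ⁻¹`, lies in `N` for
every starting point `c`. So it suffices to find `c ∈ Kˣ` for which `cₙ` avoids a given finitely
generated group (`exists_iterConj_notMem_closure`).

Choose an order over a finitely generated subring `R` of `F` that contains the generators and their
inverses, and reduce it modulo a maximal ideal `m` of `R`. With `R` large enough the quotient is a
matrix ring over a finite field with more than three elements, and `x` stays noncentral in it. There
some rank-one idempotent `e` has all four products `e x^{±1} (1 - e) x^{±1} e` nonzero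
(`Module.End.exists_rank_one_idempotent`).

Lift `e` to the order and take `c = 1 - e`, which is invertible in `K` but singular modulo `m`. A
valuation of `F` centered at `m`, extended to `K` as the maximum over coordinates, is at most one on
the whole group. But `c⁻¹` has a pole whose leading term is a multiple of `e`, and the choice of `e`
keeps leading terms from cancelling, so every `cₙ` with `n ≥ 1` has a pole
(`Valuation.Gauge.one_lt_iterConj`). -/

/-! ### Linear algebra: idempotents in general position -/

/-- Two vectors outside a subspace can be separated from it by a single linear functional. -/
theorem Submodule.exists_dual_ne_zero_of_notMem_of_notMem {E V : Type*} [Field E] [AddCommGroup V]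
    [Module E V] (W : Submodule E V) {y z : V} (hy : y ∉ W) (hz : z ∉ W) :
    ∃ θ : V →ₗ[E] E, (∀ w ∈ W, θ w = 0) ∧ θ y ≠ 0 ∧ θ z ≠ 0 := by
  obtain ⟨f, hf, hfW⟩ := W.exists_le_ker_of_notMem hy
  obtain ⟨g, hg, hgW⟩ := W.exists_le_ker_of_notMem hz
  by_cases h1 : f z = 0
  · by_cases h2 : g y = 0
    · exact ⟨f + g,
        fun w hw => by simp [LinearMap.mem_ker.1 (hfW hw), LinearMap.mem_ker.1 (hgW hw)],
        by simpa [h2] using hf, by simpa [h1] using hg⟩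
    · exact ⟨g, fun w hw => hgW hw, h2, hg⟩
  · exact ⟨f, fun w hw => hfW hw, hf, h1⟩

/-- A nonscalar automorphism `X` over a field with more than three elements admits a vector and a
functional in general position with respect to `X ^ 2`, `X`, `X⁻¹` and `X⁻²`. -/
theorem LinearEquiv.exists_vector_dual_general_position {E V : Type*} [Field E] [AddCommGroup V]
    [Module E V] (hE : 3 < Cardinal.mk E) (X : V ≃ₗ[E] V)
    (hX : ¬ ∃ a : E, ∀ v, X v = a • v) :
    ∃ (w : V) (ψ : V →ₗ[E] E), ψ w = 1 ∧ ψ (X w) = 0 ∧ ψ (X (X w)) ≠ 0 ∧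
      ψ (X.symm (X.symm w)) ≠ ψ (X.symm w) ^ 2 := by
  obtain ⟨w, hw⟩ : ∃ w, LinearIndependent E ![w, X w] := by
    by_contra! h
    obtain ⟨a, ha⟩ := LinearMap.exists_eq_smul_id_of_forall_notLinearIndependent
      (f := (X : V →ₗ[E] V)) h
    exact hX ⟨a, fun v => by simpa using congr($ha v)⟩
  obtain ⟨ψ₀, h0, h1⟩ : ∃ ψ₀ : V →ₗ[E] E, ψ₀ w = 1 ∧ ψ₀ (X w) = 0 := by
    have hn : w ∉ Submodule.span E {X w} := by
      intro h
      obtain ⟨c, hc⟩ := Submodule.mem_span_singleton.1 h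
      have := (LinearIndependent.pair_iff.1 hw) 1 (-c) (by simp [hc])
      simp at this
    obtain ⟨f, hf, hk⟩ := (Submodule.span E {X w}).exists_le_ker_of_notMem hn
    exact ⟨(f w)⁻¹ • f, by simp [hf], by
      simp [LinearMap.mem_ker.1 (hk (Submodule.mem_span_singleton_self _))]⟩
  set W := Submodule.span E {w, X w} with hW
  -- If `W` is `X`-stable, the two inequalities hold automatically; otherwise `ψ₀` can be perturbed
  -- by a functional vanishing on `W`.
  by_cases hc : X (X w) ∈ W
  · obtain ⟨α, β, hαβ⟩ := Submodule.mem_span_pair.1 hc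
    have hα : α ≠ 0 := by
      rintro rfl
      have h2 : X w = β • w := X.injective (by simpa using hαβ.symm)
      have := (LinearIndependent.pair_iff.1 hw) β (-1) (by simp [h2])
      simp at this
    have e1 : X.symm w = α⁻¹ • (X w - β • w) := by
      rw [X.symm_apply_eq, map_smul, map_sub, map_smul, ← hαβ]
      simp [smul_smul, hα]
    have e2 : X.symm (X.symm w) = α⁻¹ • (w - β • X.symm w) := by
      conv_lhs => rw [e1]
      simp
    have e3 : ψ₀ (X.symm w) = -(α⁻¹ * β) := by simp [e1, h0, h1]
    -- Here `ψ₀ (X⁻² w) - ψ₀ (X⁻¹ w) ^ 2 = α⁻¹`.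
    refine ⟨w, ψ₀, h0, h1, by simp [← hαβ, h0, h1, hα], ?_⟩
    intro h
    rw [e2, ψ₀.map_smul, ψ₀.map_sub, ψ₀.map_smul, e3, h0] at h
    have : α⁻¹ = 0 := by
      simp only [smul_eq_mul] at h
      linear_combination h
    exact hα (by simpa using this)
  · have hd : X.symm w ∉ W := by
      intro h
      obtain ⟨α, β, hαβ⟩ := Submodule.mem_span_pair.1 h
      have h2 : w = α • X w + β • X (X w) := by
        have := congrArg X hαβ
        simpa using this.symm
      by_cases hβ : β = 0
      · have := (LinearIndependent.pair_iff.1 hw) 1 (-α) (by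
          rw [hβ, zero_smul, add_zero] at h2
          rw [one_smul, neg_smul, ← h2, add_neg_cancel])
        simp at this
      · refine hc (Submodule.mem_span_pair.2 ⟨β⁻¹, -(β⁻¹ * α), ?_⟩)
        conv_lhs => enter [1]; rw [h2]
        simp [smul_smul, hβ]
    obtain ⟨θ, hθW, hθ1, hθ2⟩ := W.exists_dual_ne_zero_of_notMem_of_notMem hc hd
    have hθw : θ w = 0 := hθW _ (Submodule.subset_span (by simp))
    have hθX : θ (X w) = 0 := hθW _ (Submodule.subset_span (by simp))
    -- For `ψ = ψ₀ + s • θ` the two quantities to keep nonzero are polynomials in `s` of degrees 1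
    -- and 2; this is where more than three scalars are needed.
    let p : Polynomial E := .C (θ (X (X w))) * .X + .C (ψ₀ (X (X w)))
    let q : Polynomial E := .C (-(θ (X.symm w)) ^ 2) * .X ^ 2 +
      .C (θ (X.symm (X.symm w)) - 2 * ψ₀ (X.symm w) * θ (X.symm w)) * .X +
      .C (ψ₀ (X.symm (X.symm w)) - ψ₀ (X.symm w) ^ 2)
    have hp : p.natDegree = 1 := Polynomial.natDegree_linear hθ1
    have hq : q.natDegree = 2 := Polynomial.natDegree_quadratic (by simpa using hθ2)
    have hp0 : p ≠ 0 := by rintro h; simp [h] at hp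
    have hq0 : q ≠ 0 := by rintro h; simp [h] at hq
    obtain ⟨s, hs⟩ := Polynomial.exists_eval_ne_zero_of_natDegree_lt_card (p * q)
      (mul_ne_zero hp0 hq0) (by rw [Polynomial.natDegree_mul hp0 hq0, hp, hq]; exact_mod_cast hE)
    rw [Polynomial.eval_mul] at hs
    refine ⟨w, ψ₀ + s • θ, by simp [h0, hθw], by simp [h1, hθX], ?_, ?_⟩
    · intro h
      apply left_ne_zero_of_mul hs
      simp only [LinearMap.add_apply, LinearMap.smul_apply, smul_eq_mul] at h
      simp only [p, Polynomial.eval_add, Polynomial.eval_mul, Polynomial.eval_C, Polynomial.eval_X]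
      linear_combination h
    · intro h
      apply right_ne_zero_of_mul hs
      simp only [LinearMap.add_apply, LinearMap.smul_apply, smul_eq_mul] at h
      simp only [q, Polynomial.eval_add, Polynomial.eval_mul, Polynomial.eval_C, Polynomial.eval_X,
        Polynomial.eval_pow]
      linear_combination h

/-- For a noncentral automorphism `X` of a vector space over a field with more than three elements
there is a rank-one idempotent `e` such that all four products `e X^{±1} (1 - e) X^{±1} e` are
nonzero. -/
theorem Module.End.exists_rank_one_idempotent {E V : Type*} [Field E] [AddCommGroup V]
    [Module E V] (hE : 3 < Cardinal.mk E) {X Y : Module.End E V} (hXY : X * Y = 1)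
    (hYX : Y * X = 1) (hX : ¬ ∀ Z, X * Z = Z * X) :
    ∃ e : Module.End E V, e * e = e ∧ e ≠ 0 ∧ (∀ Z, ∃ c : E, e * Z * e = c • e) ∧
      ∀ u, u = X ∨ u = Y → ∀ v, v = X ∨ v = Y →
        ∃ c : E, c ≠ 0 ∧ e * u * (1 - e) * v * e = c • e := by
  obtain ⟨w, ψ, h0, h1, h2, h3⟩ := LinearEquiv.exists_vector_dual_general_position hE
    (LinearEquiv.ofLinearMap X Y hXY hYX) (by
      rintro ⟨a, ha⟩
      refine hX fun Z => LinearMap.ext fun v => ?_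
      change X (Z v) = Z (X v)
      have ha' : ∀ v, X v = a • v := ha
      rw [ha', ha', map_smul])
  replace h1 : ψ (X w) = 0 := h1
  replace h2 : ψ (X (X w)) ≠ 0 := h2
  replace h3 : ψ (Y (Y w)) ≠ ψ (Y w) ^ 2 := h3
  have hxy : X (Y w) = w := congr($hXY w)
  have hyx : Y (X w) = w := congr($hYX w)
  have hrank : ∀ Z : Module.End E V, ψ.smulRight w * Z * ψ.smulRight w = ψ (Z w) • ψ.smulRight w := by
    intro Z
    ext v
    simp [smul_smul, mul_comm]
  have hidem : ψ.smulRight w * ψ.smulRight w = ψ.smulRight w := by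
    simpa [h0] using hrank 1
  refine ⟨ψ.smulRight w, hidem, fun h => ?_, fun Z => ⟨_, hrank Z⟩, ?_⟩
  · have := congr(ψ ($h w))
    simp [h0] at this
  · intro u hu v hv
    -- Since `ψ (X w) = 0` and `ψ w = 1`, this is `ψ (X² w)` for `X, X`, one in the mixed cases, and
    -- `ψ (Y² w) - ψ (Y w) ^ 2` for `Y, Y`.
    refine ⟨ψ (u (v w)) - ψ (u w) * ψ (v w), ?_, ?_⟩
    · rcases hu with rfl | rfl <;> rcases hv with rfl | rfl
      · simpa [h1] using h2
      · simp [h1, hxy, h0]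
      · simp [h1, hyx, h0]
      · exact sub_ne_zero.2 (by rwa [← sq])
    · have e1 : ψ.smulRight w * u * (1 - ψ.smulRight w) * v * ψ.smulRight w =
          ψ.smulRight w * (u * v) * ψ.smulRight w -
          (ψ.smulRight w * u * ψ.smulRight w) * v * ψ.smulRight w := by noncomm_ring
      rw [e1, hrank, hrank, smul_mul_assoc, smul_mul_assoc, hrank, smul_smul, ← sub_smul]
      rfl

/-! ### Two-sided multiplications -/

/-- Every linear endomorphism of a finite-dimensional central division algebra is a sum of
two-sided multiplications. -/
theorem LinearMap.exists_eq_sum_mul_mul {F D : Type*} [Field F] [DivisionRing D] [Algebra F D]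
    [FiniteDimensional F D] [Algebra.IsCentral F D] (T : D →ₗ[F] D) :
    ∃ S : Finset (D × D), ∀ d, T d = ∑ p ∈ S, p.1 * d * p.2 := by
  classical
  let A := (AlgHom.mulLeftRight F D).range
  have act : ∀ (t : A) (d : D), t • d = (t : Module.End F D) d := fun _ _ => rfl
  let lr : D → D → A := fun a c => ⟨AlgHom.mulLeftRight F D (a ⊗ₜ .op c), ⟨_, rfl⟩⟩
  have hlr : ∀ a c d, lr a c • d = a * d * c := fun a c d => by
    rw [act]; exact AlgHom.mulLeftRight_apply F D a (.op c) d
  have : IsSimpleModule A D := isSimpleModule_iff_toSpanSingleton_surjective.mpr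
    ⟨inferInstance, fun m hm w => ⟨lr (w * m⁻¹) 1, by simp [hlr, hm]⟩⟩
  have hcomm : ∀ φ : Module.End A D, ∃ c : F, ∀ d, φ d = c • d := by
    intro φ
    have h1 : ∀ d, φ d = d * φ 1 := fun d => by
      simpa [hlr] using φ.map_smul (lr d 1) 1
    have h2 : ∀ d, φ d = φ 1 * d := fun d => by
      simpa [hlr] using φ.map_smul (lr 1 d) 1
    obtain ⟨c, hc⟩ := (Algebra.IsCentral.mem_center_iff F).1
      (Subalgebra.mem_center_iff.2 fun d => by rw [← h1, ← h2] : φ 1 ∈ Subalgebra.center F D)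
    exact ⟨c, fun d => by rw [h2, hc, Algebra.smul_def]⟩
  -- `D` is simple over its multiplication algebra with only scalars as endomorphisms, so `T` lies
  -- in the bicommutant and density applies on a basis.
  let f : Module.End (Module.End A D) D :=
    { toFun := T
      map_add' := T.map_add
      map_smul' := fun φ d => by
        obtain ⟨c, hc⟩ := hcomm φ
        simp [hc] }
  let b := Module.finBasis F D
  obtain ⟨r, hr⟩ := jacobson_density (R := A) (M := D) f (Finset.univ.image b)
  have hT : T = r := b.ext fun i => hr (b i) (by simp)
  obtain ⟨t, ht⟩ := r.2
  obtain ⟨S, hS⟩ := TensorProduct.exists_finset t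
  refine ⟨S.map ⟨fun p => (p.1, p.2.unop), fun p q h => by
    simpa [Prod.ext_iff] using h⟩, fun d => ?_⟩
  rw [hT, ← ht, hS]
  rw [Finset.sum_map]
  simp [map_sum, LinearMap.sum_apply, AlgHom.mulLeftRight_apply]
  rfl

/-! ### Finite residue rings -/

instance Int.instIsJacobsonRing : IsJacobsonRing ℤ := by
  refine isJacobsonRing_iff_prime_eq.2 fun P hP => ?_
  by_cases h : P = ⊥
  · subst h
    refine le_antisymm (fun x hx => ?_) Ideal.le_jacobson
    have h0 : x = 0 := by
      rcases Int.isUnit_iff.1 (Ideal.mem_jacobson_bot.1 hx x) with h | h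
      · simpa using h
      · nlinarith [mul_self_nonneg x]
    simp [h0]
  · exact Ideal.jacobson_eq_self_of_isMaximal (H := hP.isMaximal h)

/-- A field which is finitely generated as a ring is finite. -/
theorem Field.finite_of_finiteType_int (K : Type*) [Field K] [Algebra.FiniteType ℤ K] :
    Finite K := by
  -- Zariski's lemma over the Jacobson ring `ℤ`; in characteristic zero integrality would make `ℤ` a
  -- field.
  have : Module.Finite ℤ K := finite_of_finite_type_of_isJacobsonRing ℤ K
  obtain ⟨p, hp⟩ := CharP.exists K
  rcases CharP.char_is_prime_or_zero K p with h | h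
  · have : Fact p.Prime := ⟨h⟩
    algebraize [ZMod.castHom (dvd_refl p) K]
    have : Module.Finite (ZMod p) K := Module.Finite.of_restrictScalars_finite ℤ _ _
    exact Module.finite_of_finite (ZMod p)
  · subst h
    have : CharZero K := CharP.charP_to_charZero K
    exact (Int.not_isField (isField_of_isIntegral_of_isField
      (FaithfulSMul.algebraMap_injective ℤ K) (Field.toIsField K))).elim

/-- The residue fields of a finitely generated commutative ring are finite. -/
theorem Ideal.finite_quotient_of_isMaximal_of_finiteType_int {R : Type*} [CommRing R]
    [Algebra.FiniteType ℤ R] (m : Ideal R) [m.IsMaximal] : Finite (R ⧸ m) := by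
  have h : Algebra.FiniteType ℤ (R ⧸ m) := inferInstance
  let := Ideal.Quotient.field m
  exact @Field.finite_of_finiteType_int (R ⧸ m) _ h

/-- A finite simple ring is a matrix ring over a finite field. -/
theorem IsSimpleRing.exists_ringEquiv_moduleEnd_of_finite.{u} (Q : Type u) [Ring Q] [Finite Q]
    [IsSimpleRing Q] : ∃ (n : ℕ) (E : Type u) (_ : Field E) (_ : Finite E),
      Nonempty (Q ≃+* Module.End E (Fin n → E)) := by
  obtain ⟨n, hn, E, hE, ⟨φ⟩⟩ := IsSimpleRing.exists_ringEquiv_matrix_divisionRing Q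
  have : Finite (Matrix (Fin n) (Fin n) E) := Finite.of_equiv _ φ.toEquiv
  have : Finite E := Finite.of_injective (fun a : E => Matrix.scalar (Fin n) a)
    fun a b h => by simpa using congrFun (congrFun h 0) 0
  exact ⟨n, E, littleWedderburn E, this, ⟨φ.trans Matrix.toLinAlgEquiv'.toRingEquiv⟩⟩

/-- A subring generated by a finite set is a `ℤ`-algebra of finite type. -/
theorem Subring.finiteType_int_closure {K : Type*} [CommRing K] {s : Set K} (hs : s.Finite) :
    Algebra.FiniteType ℤ (Subring.closure s) := by
  have : Algebra.FiniteType ℤ (subalgebraOfSubring (Subring.closure s)) := by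
    rw [← Algebra.adjoin_int]
    exact (Subalgebra.fg_iff_finiteType _).1 ⟨hs.toFinset, by simp⟩
  exact this

/-! ### Iterated conjugates and subnormality -/

/-- The iterated conjugates `c₀ = c`, `cₙ₊₁ = cₙ x cₙ⁻¹`. -/
def iterConj {G : Type*} [Mul G] [Inv G] (x c : G) : ℕ → G
  | 0 => c
  | n + 1 => iterConj x c n * x * (iterConj x c n)⁻¹

theorem Units.val_iterConj {D : Type*} [DivisionRing D] (x c : Dˣ) (n : ℕ) :
    (iterConj x c n : Dˣ) = iterConj (x : D) (c : D) n := by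
  induction n with
  | zero => rfl
  | succ n ih => simp [iterConj, ih]

theorem map_iterConj {G H : Type*} [Group G] [Group H] (f : G →* H) (x c : G) (n : ℕ) :
    f (iterConj x c n) = iterConj (f x) (f c) n := by
  induction n with
  | zero => rfl
  | succ n ih => simp [iterConj, ih]

/-- Subnormality captures iterated conjugates. -/
theorem Subgroup.IsSubnormal.exists_iterConj_mem {G : Type*} [Group G] {N : Subgroup G}
    (hN : N.IsSubnormal) : ∃ n : ℕ, ∀ x ∈ N, ∀ c : G, iterConj x c (n + 1) ∈ N := by
  -- The shift keeps the index positive: the starting element `1 - e` itself will be integral.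
  suffices h : ∃ n : ℕ, ∀ x ∈ N, ∀ c : G, iterConj x c n ∈ N by
    obtain ⟨n, hn⟩ := h
    exact ⟨n, fun x hx c => N.mul_mem (N.mul_mem (hn x hx c) hx) (N.inv_mem (hn x hx c))⟩
  induction hN with
  | top => exact ⟨0, fun _ _ _ => trivial⟩
  | step H K hle _ hnorm ih =>
    obtain ⟨n, hn⟩ := ih
    exact ⟨n + 1, fun x hx c =>
      hnorm.conj_mem ⟨x, hle hx⟩ hx ⟨iterConj x c n, hn x (hle hx) c⟩⟩

/-! ### Gauges and the growth of iterated conjugates -/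

/-- A submultiplicative ultrametric gauge on an algebra over a valued field, with the same value
set as the valuation. -/
structure Valuation.Gauge {F Γ : Type*} [Field F] [LinearOrderedCommGroupWithZero Γ]
    (v : Valuation F Γ) (D : Type*) [DivisionRing D] [Algebra F D] where
  toFun : D → Γ
  one_le' : toFun 1 ≤ 1
  add_le' : ∀ x y, toFun (x + y) ≤ max (toFun x) (toFun y)
  mul_le' : ∀ x y, toFun (x * y) ≤ toFun x * toFun y
  smul' : ∀ (c : F) x, toFun (c • x) = v c * toFun x
  exists_eq' : ∀ x, x ≠ 0 → ∃ c : F, c ≠ 0 ∧ toFun x = v c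

namespace Valuation.Gauge

variable {F Γ : Type*} [Field F] [LinearOrderedCommGroupWithZero Γ] {v : Valuation F Γ}
  {D : Type*} [DivisionRing D] [Algebra F D] (g : v.Gauge D)

instance : CoeFun (v.Gauge D) fun _ => D → Γ := ⟨toFun⟩

theorem map_zero : g 0 = 0 := by simpa using g.smul' 0 0

theorem map_neg (x : D) : g (-x) = g x := by simpa using g.smul' (-1) x

theorem sub_le (x y : D) : g (x - y) ≤ max (g x) (g y) := by
  simpa [sub_eq_add_neg, g.map_neg] using g.add_le' x (-y)

theorem mul_le_one {x y : D} (hx : g x ≤ 1) (hy : g y ≤ 1) : g (x * y) ≤ 1 :=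
  (g.mul_le' x y).trans (mul_le_one' hx hy)

theorem mul_lt_one_left {x y : D} (hx : g x < 1) (hy : g y ≤ 1) : g (x * y) < 1 :=
  (g.mul_le' x y).trans_lt ((mul_le_of_le_one_right' hy).trans_lt hx)

theorem mul_lt_one_right {x y : D} (hx : g x ≤ 1) (hy : g y < 1) : g (x * y) < 1 :=
  (g.mul_le' x y).trans_lt ((mul_le_of_le_one_left' hx).trans_lt hy)

/-- Congruence modulo the elements of gauge less than one. -/
def Congr (x y : D) : Prop := g (x - y) < 1

variable {g}

theorem Congr.refl (x : D) : g.Congr x x := by simp [Congr, g.map_zero]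

theorem Congr.trans {x y z : D} (h : g.Congr x y) (h' : g.Congr y z) : g.Congr x z := by
  have : x - z = (x - y) + (y - z) := by abel
  rw [Congr, this]
  exact (g.add_le' _ _).trans_lt (max_lt h h')

theorem Congr.symm {x y : D} (h : g.Congr x y) : g.Congr y x := by
  rw [Congr, ← neg_sub, g.map_neg]; exact h

theorem Congr.le_one {x y : D} (h : g.Congr x y) (hy : g y ≤ 1) : g x ≤ 1 := by
  have := g.add_le' (x - y) y
  rw [sub_add_cancel] at this
  exact this.trans (max_le h.le hy)

theorem Congr.lt_one {x y : D} (h : g.Congr x y) (hy : g y < 1) : g x < 1 := by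
  have := g.add_le' (x - y) y
  rw [sub_add_cancel] at this
  exact this.trans_lt (max_lt h hy)

theorem Congr.mul {x x' y y' : D} (h : g.Congr x x') (h' : g.Congr y y') (hx : g x' ≤ 1)
    (hy : g y' ≤ 1) : g.Congr (x * y) (x' * y') := by
  have : x * y - x' * y' = (x - x') * y + x' * (y - y') := by noncomm_ring
  rw [Congr, this]
  exact (g.add_le' _ _).trans_lt
    (max_lt (g.mul_lt_one_left h (h'.le_one hy)) (g.mul_lt_one_right hx h'))

theorem Congr.smul {x y : D} (h : g.Congr x y) {c : F} (hc : v c ≤ 1) :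
    g.Congr (c • x) (c • y) := by
  rw [Congr, ← smul_sub, g.smul']
  exact (mul_le_of_le_one_left' hc).trans_lt h

variable (g)

/-- If `e` is a rank-one idempotent modulo the elements of gauge less than one and the four
products `e x^{±1} (1 - e) x^{±1} e` are unit multiples of `e`, then no iterated conjugate of `x`
by `1 - e` is integral. -/
theorem one_lt_iterConj {x e : D} (hx : g x ≤ 1) (hx' : g x⁻¹ ≤ 1) (he : g e ≤ 1)
    (he1 : ¬ g e < 1) (hee : g.Congr (e * e) e)
    (hrank : ∀ y, g y ≤ 1 → ∃ c : F, g.Congr (e * y * e) (c • e))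
    (hprod : ∀ u, u = x ∨ u = x⁻¹ → ∀ w, w = x ∨ w = x⁻¹ →
      ∃ c : F, v c = 1 ∧ g.Congr (e * u * (1 - e) * w * e) (c • e)) :
    1 - e ≠ 0 ∧ ∀ n, 1 < g (iterConj x (1 - e) (n + 1)) := by
  set f := 1 - e with hf
  have hge : g e = 1 := le_antisymm he (not_lt.1 he1)
  have hf1 : g f ≤ 1 := (g.sub_le _ _).trans (max_le g.one_le' he)
  have hunit : ∀ u, u = x ∨ u = x⁻¹ → g u ≤ 1 := by rintro u (rfl | rfl) <;> assumption
  have hsmul : ∀ {c : F} {y : D}, v c = 1 → g (c • y) = g y := fun h => by rw [g.smul', h, one_mul]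
  have hf0 : f ≠ 0 := by
    intro h0
    obtain ⟨c, hc, h⟩ := hprod x (.inl rfl) x (.inl rfl)
    rw [h0, mul_zero, zero_mul, zero_mul] at h
    have := h.symm.lt_one (by rw [g.map_zero]; exact zero_lt_one)
    rw [hsmul hc] at this
    exact he1 this
  refine ⟨hf0, ?_⟩
  obtain ⟨ν, hν0, hν⟩ := g.exists_eq' f⁻¹ (inv_ne_zero hf0)
  have hvν : v ν ≠ 0 := (v.ne_zero_iff).2 hν0
  -- the normalised inverse
  set a := ν⁻¹ • f⁻¹ with ha
  have hga : g a = 1 := by rw [ha, g.smul', hν, map_inv₀, inv_mul_cancel₀ hvν]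
  have hfa : f * a = ν⁻¹ • 1 := by rw [ha, mul_smul_comm, mul_inv_cancel₀ hf0]
  have haf : a * f = ν⁻¹ • 1 := by rw [ha, smul_mul_assoc, inv_mul_cancel₀ hf0]
  have hef : g (e * f) < 1 := by
    have : e * f = e - e * e := by rw [hf]; noncomm_ring
    rw [this]; exact hee.symm
  -- `e f a = ν⁻¹ e` is small because `e f` is; as `e` has gauge one, `f⁻¹` has gauge greater than
  -- one.
  have hν1 : v ν⁻¹ < 1 := by
    have h1 : ν⁻¹ • e = e * f * a := by rw [mul_assoc, hfa, mul_smul_comm, mul_one]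
    have h2 := g.mul_lt_one_left hef hga.le
    rwa [← h1, g.smul', hge, mul_one] at h2
  have hscal : g (ν⁻¹ • (1 : D)) < 1 := by
    rw [g.smul']; exact (mul_le_of_le_one_right' g.one_le').trans_lt hν1
  -- Both `f a` and `a f` equal the small scalar `ν⁻¹`, so only the `e`-corner of `a` survives.
  have hae : g.Congr a (e * a * e) := by
    have : a - e * a * e = ν⁻¹ • 1 + e * (ν⁻¹ • 1) := by
      rw [← hfa]
      nth_rewrite 2 [hfa]
      rw [← haf, hf]; noncomm_ring
    rw [Congr, this]
    exact (g.add_le' _ _).trans_lt (max_lt hscal (g.mul_lt_one_right he hscal))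
  obtain ⟨l, hl⟩ := hrank a hga.le
  replace hl := hae.trans hl
  have hl1 : v l = 1 := by
    have h1 : g (l • e) ≤ 1 := hl.symm.le_one hga.le
    rw [g.smul', hge, mul_one] at h1
    refine le_antisymm h1 (not_lt.1 fun h => ?_)
    have := hl.lt_one (by rwa [g.smul', hge, mul_one])
    exact this.ne hga
  have hfxe : ∀ w, w = x ∨ w = x⁻¹ → g (f * w * e) ≤ 1 := fun w hw =>
    g.mul_le_one (g.mul_le_one hf1 (hunit w hw)) he
  have hfxe1 : ¬ g (f * x * e) < 1 := by
    intro h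
    obtain ⟨c, hc, h'⟩ := hprod x (.inl rfl) x (.inl rfl)
    have h2 := g.mul_lt_one_right (g.mul_le_one he hx) h
    have h3 := h'.symm.lt_one (by simpa only [mul_assoc] using h2)
    rw [hsmul hc] at h3
    exact he1 h3
  have hstep : ∀ {P P' : D} {μ μ' : F} {u w : D}, u = x ∨ u = x⁻¹ → w = x ∨ w = x⁻¹ → v μ = 1 →
      v μ' = 1 → g.Congr P (μ • (f * x * e)) → g.Congr P' (μ' • (f * w * e)) →
      ∃ μ'' : F, v μ'' = 1 ∧ g.Congr (P * u * P') (μ'' • (f * x * e)) := by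
    intro P P' μ μ' u w hu hw hμ hμ' hP hP'
    obtain ⟨c, hc, h⟩ := hprod u hu w hw
    refine ⟨μ * μ' * c, by simp [hμ, hμ', hc], ?_⟩
    have hgx : g (μ • (f * x * e)) ≤ 1 := by rw [hsmul hμ]; exact hfxe x (.inl rfl)
    have h1 := (hP.mul (Congr.refl u) hgx (hunit u hu)).mul hP' (g.mul_le_one hgx (hunit u hu))
      (by rw [hsmul hμ']; exact hfxe w hw)
    have h2 := ((Congr.refl (f * x)).mul h (g.mul_le_one hf1 hx)
      (by rw [hsmul hc]; exact he)).smul (c := μ * μ') (by simp [hμ, hμ'])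
    refine h1.trans ?_
    convert h2 using 1
    · simp [smul_smul, mul_assoc, mul_comm]
    · simp [smul_smul]
  -- The gauge is only submultiplicative, so inverses are followed too. At `n = 0` the inverse is `f
  -- x⁻¹ f⁻¹`, whence `w = x⁻¹`; afterwards both leading terms are multiples of `f x e`. Thus all
  -- four sign choices in `hprod` occur.
  have hind : ∀ n, ∃ (s s' : F) (μ μ' : F) (w : D), v s < 1 ∧ v s' ≤ 1 ∧ v μ = 1 ∧
      v μ' = 1 ∧ (w = x ∨ w = x⁻¹) ∧
      g.Congr (s • iterConj x f (n + 1)) (μ • (f * x * e)) ∧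
      g.Congr (s' • (iterConj x f (n + 1))⁻¹) (μ' • (f * w * e)) := by
    intro n
    induction n with
    | zero =>
      refine ⟨ν⁻¹, ν⁻¹, l, l, x⁻¹, hν1, hν1.le, hl1, hl1, .inr rfl, ?_, ?_⟩
      · have := (Congr.refl (g := g) (f * x)).mul hl (g.mul_le_one hf1 hx) (by rw [hsmul hl1, hge])
        simpa [iterConj, ha] using this
      · have := (Congr.refl (g := g) (f * x⁻¹)).mul hl (g.mul_le_one hf1 hx')
          (by rw [hsmul hl1, hge])
        simpa [iterConj, ha, mul_assoc] using this
    | succ n ih =>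
      obtain ⟨s, s', μ, μ', w, hs, hs', hμ, hμ', hw, hP, hP'⟩ := ih
      obtain ⟨μ₁, hμ₁, h₁⟩ := hstep (.inl rfl) hw hμ hμ' hP hP'
      obtain ⟨μ₂, hμ₂, h₂⟩ := hstep (.inr rfl) hw hμ hμ' hP hP'
      have hs1 : v (s * s') < 1 := by
        rw [map_mul]; exact (mul_le_of_le_one_right' hs').trans_lt hs
      refine ⟨s * s', s * s', μ₁, μ₂, x, hs1, hs1.le, hμ₁, hμ₂, .inl rfl,
        ?_, ?_⟩
      · rw [iterConj]
        convert h₁ using 1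
        simp [smul_smul, mul_comm]
      · rw [iterConj]
        convert h₂ using 1
        simp [smul_smul, mul_comm, mul_assoc]
  intro n
  obtain ⟨s, s', μ, μ', w, hs, -, hμ, -, -, hP, -⟩ := hind n
  by_contra! hle
  have := hP.symm.lt_one (by
    rw [g.smul']; exact (mul_le_of_le_one_right' hle).trans_lt hs)
  rw [hsmul hμ] at this
  exact hfxe1 this

end Valuation.Gauge

/-! ### The gauge of a basis -/

theorem Module.Basis.repr_mul_apply {ι F D : Type*} [Fintype ι] [Field F] [Ring D] [Algebra F D]
    (b : Module.Basis ι F D) (x y : D) (k : ι) :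
    b.repr (x * y) k = ∑ i, ∑ j, b.repr x i * b.repr y j * b.repr (b i * b j) k := by
  conv_lhs => rw [← b.sum_repr x, ← b.sum_repr y]
  simp only [Finset.sum_mul_sum, map_sum, Finsupp.finsetSum_apply, smul_mul_smul_comm, map_smul,
    Finsupp.smul_apply, smul_eq_mul]

/-- The supremum of the values of the coordinates with respect to a basis with integral structure
constants. -/
noncomputable def Valuation.Gauge.ofBasis {ι F Γ D : Type*} [Fintype ι] [Field F]
    [LinearOrderedCommGroupWithZero Γ] (v : Valuation F Γ) [DivisionRing D] [Algebra F D]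
    (b : Module.Basis ι F D) (hone : ∀ k, v (b.repr 1 k) ≤ 1)
    (hmul : ∀ i j k, v (b.repr (b i * b j) k) ≤ 1) : v.Gauge D where
  toFun d := Finset.univ.sup fun k => v (b.repr d k)
  one_le' := Finset.sup_le fun k _ => hone k
  add_le' x y := Finset.sup_le fun k _ => by
    rw [map_add, Finsupp.add_apply]
    exact (v.map_add _ _).trans (max_le_max
      (Finset.le_sup (f := fun k => v (b.repr x k)) (Finset.mem_univ k))
      (Finset.le_sup (f := fun k => v (b.repr y k)) (Finset.mem_univ k)))
  mul_le' x y := Finset.sup_le fun k _ => by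
    rw [b.repr_mul_apply]
    refine v.map_sum_le fun i _ => v.map_sum_le fun j _ => ?_
    rw [map_mul, map_mul]
    exact (mul_le_of_le_one_right' (hmul i j k)).trans (mul_le_mul'
      (Finset.le_sup (f := fun k => v (b.repr x k)) (Finset.mem_univ i))
      (Finset.le_sup (f := fun k => v (b.repr y k)) (Finset.mem_univ j)))
  smul' c x := by
    refine le_antisymm (Finset.sup_le fun k _ => ?_) ?_
    · simpa using mul_le_mul_right
        (Finset.le_sup (f := fun k => v (b.repr x k)) (Finset.mem_univ k)) (v c)
    · rcases (Finset.univ : Finset ι).eq_empty_or_nonempty with h | h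
      · simp [h, bot_eq_zero]
      · obtain ⟨k, hk, h⟩ := Finset.exists_mem_eq_sup _ h fun k => v (b.repr x k)
        rw [h]
        simpa using Finset.le_sup (f := fun k => v (b.repr (c • x) k)) hk
  exists_eq' x hx := by
    obtain ⟨i, hi⟩ : ∃ i, b.repr x i ≠ 0 := by
      by_contra! h
      exact hx (b.ext_elem fun i => by simpa using h i)
    obtain ⟨k, hk, h⟩ := Finset.exists_mem_eq_sup _ ⟨i, Finset.mem_univ i⟩ fun k => v (b.repr x k)
    refine ⟨b.repr x k, fun h0 => hi ?_, h⟩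
    have := Finset.le_sup (f := fun k => v (b.repr x k)) (Finset.mem_univ i)
    rw [h, h0, v.map_zero] at this
    simpa using this

namespace Valuation.Gauge

variable {ι F Γ D : Type*} [Fintype ι] [Field F] [LinearOrderedCommGroupWithZero Γ]
  {v : Valuation F Γ} [DivisionRing D] [Algebra F D] {b : Module.Basis ι F D}
  {hone : ∀ k, v (b.repr 1 k) ≤ 1} {hmul : ∀ i j k, v (b.repr (b i * b j) k) ≤ 1}

theorem ofBasis_le_one_iff {d : D} : ofBasis v b hone hmul d ≤ 1 ↔ ∀ k, v (b.repr d k) ≤ 1 := by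
  change (Finset.univ.sup fun k => v (b.repr d k)) ≤ 1 ↔ _
  simp

theorem ofBasis_lt_one_iff {d : D} : ofBasis v b hone hmul d < 1 ↔ ∀ k, v (b.repr d k) < 1 := by
  change (Finset.univ.sup fun k => v (b.repr d k)) < 1 ↔ _
  rw [Finset.sup_lt_iff (by rw [bot_eq_zero]; exact zero_lt_one)]
  simp

end Valuation.Gauge

/-! ### Orders and their reductions -/

/-- The structure constants of a basis, and the coordinates of `1`, lie in a given subring. -/
structure IsIntegralBasis {ι F D : Type*} [Field F] [Ring D] [Algebra F D]
    (b : Module.Basis ι F D) (R : Subring F) : Prop where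
  one : ∀ k, b.repr 1 k ∈ R
  mul : ∀ i j k, b.repr (b i * b j) k ∈ R

namespace IsIntegralBasis

variable {ι F D : Type*} [Fintype ι] [Field F] [Ring D] [Algebra F D] {b : Module.Basis ι F D}
  {R : Subring F} (h : IsIntegralBasis b R)

/-- The order spanned by a basis with integral structure constants. -/
noncomputable def order : Subalgebra R D where
  carrier := {d | ∀ k, b.repr d k ∈ R}
  mul_mem' {x y} hx hy k := by
    rw [b.repr_mul_apply]
    exact sum_mem fun i _ => sum_mem fun j _ => R.mul_mem (R.mul_mem (hx i) (hy j)) (h.mul i j k)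
  add_mem' {x y} hx hy k := by
    rw [map_add]; exact R.add_mem (hx k) (hy k)
  algebraMap_mem' r k := by
    have : algebraMap R D r = (r : F) • (1 : D) := by
      rw [Algebra.smul_def, mul_one]; rfl
    rw [this, map_smul]
    exact R.mul_mem r.2 (h.one k)

/-- The integral coordinates of an element of the order. -/
noncomputable def coord (d : h.order) (k : ι) : R := ⟨b.repr d k, d.2 k⟩

theorem coord_mul (x y : h.order) (k : ι) : h.coord (x * y) k =
    ∑ i, ∑ j, h.coord x i * h.coord y j * ⟨b.repr (b i * b j) k, h.mul i j k⟩ := by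
  apply Subtype.ext
  push_cast
  exact b.repr_mul_apply _ _ _

theorem coord_add (x y : h.order) (k : ι) : h.coord (x + y) k = h.coord x k + h.coord y k :=
  Subtype.ext (by simp [coord])

theorem coord_sub (x y : h.order) (k : ι) : h.coord (x - y) k = h.coord x k - h.coord y k :=
  Subtype.ext (by simp [coord])

theorem coord_smul (r : R) (x : h.order) (k : ι) : h.coord (r • x) k = r * h.coord x k :=
  Subtype.ext (by
    change b.repr ((r : F) • (x : D)) k = _
    simp [coord])

/-- The elements of the order with coordinates in a given ideal. -/
noncomputable def ideal (m : Ideal R) : Ideal h.order where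
  carrier := {d | ∀ k, h.coord d k ∈ m}
  zero_mem' k := by
    have : h.coord 0 k = 0 := Subtype.ext (by simp [coord])
    rw [this]; exact m.zero_mem
  add_mem' {x y} hx hy k := by rw [coord_add]; exact m.add_mem (hx k) (hy k)
  smul_mem' x y hy k := by
    rw [smul_eq_mul, coord_mul]
    exact sum_mem fun i _ => sum_mem fun j _ => m.mul_mem_right _ (m.mul_mem_left _ (hy j))

theorem mem_ideal {m : Ideal R} {d : h.order} : d ∈ h.ideal m ↔ ∀ k, h.coord d k ∈ m := Iff.rfl

instance (m : Ideal R) : (h.ideal m).IsTwoSided :=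
  ⟨fun {x} y hx k => by
    rw [coord_mul]
    exact sum_mem fun i _ => sum_mem fun j _ => m.mul_mem_right _ (m.mul_mem_right _ (hx i))⟩

instance (m : Ideal R) [Finite (R ⧸ m)] : Finite (h.order ⧸ h.ideal m) := by
  refine Finite.of_injective
    (fun q k => Ideal.Quotient.mk m (h.coord (Quotient.out q) k) : _ → ι → R ⧸ m) fun q q' hq => ?_
  rw [← Ideal.Quotient.mk_out q, ← Ideal.Quotient.mk_out q', Ideal.Quotient.eq, mem_ideal]
  intro k
  rw [coord_sub, ← Ideal.Quotient.eq]
  exact congrFun hq k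

/-- `1` need not be a basis vector; a unit coordinate of `1` suffices to detect scalars. -/
theorem smul_one_mem_ideal_iff {m : Ideal R} {i : ι} (hi : IsUnit (h.coord 1 i)) {r : R} :
    r • (1 : h.order) ∈ h.ideal m ↔ r ∈ m := by
  refine ⟨fun hr => ?_, fun hr k => ?_⟩
  · have := hr i
    rw [coord_smul] at this
    exact (m.mul_unit_mem_iff_mem hi).1 this
  · rw [coord_smul]; exact m.mul_mem_right _ hr

end IsIntegralBasis

/-- The quotient of the order by a maximal ideal of scalars is a simple ring, provided the
coordinate projections are given by integral two-sided multiplications. -/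
theorem IsIntegralBasis.isSimpleRing_quotient {ι F D : Type*} [Fintype ι] [Field F] [Ring D]
    [Algebra F D] {b : Module.Basis ι F D} {R : Subring F} (h : IsIntegralBasis b R)
    {i : ι} (hi : IsUnit (h.coord 1 i))
    (hT : ∀ k, ∃ S : Finset (h.order × h.order), ∀ d : h.order,
      h.coord d k • (1 : h.order) = ∑ p ∈ S, p.1 * d * p.2)
    (m : Ideal R) [hm : m.IsMaximal] : IsSimpleRing (h.order ⧸ h.ideal m) := by
  have : Nontrivial (h.order ⧸ h.ideal m) := Ideal.Quotient.nontrivial_iff.2 fun h1 => by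
    have : (1 : R) • (1 : h.order) ∈ h.ideal m := by rw [h1]; trivial
    exact m.one_notMem ((h.smul_one_mem_ideal_iff hi).1 this)
  refine ⟨{ eq_bot_or_eq_top := fun I => or_iff_not_imp_left.2 fun hI => ?_ }⟩
  obtain ⟨q, hq, hq0⟩ : ∃ q ∈ I, q ≠ 0 := by
    by_contra! hc
    exact hI (eq_bot_iff.2 fun q hq => by simpa using hc q hq)
  obtain ⟨d, rfl⟩ := Ideal.Quotient.mk_surjective q
  obtain ⟨k, hk⟩ : ∃ k, h.coord d k ∉ m := by
    by_contra! hc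
    exact hq0 (Ideal.Quotient.eq_zero_iff_mem.2 hc)
  obtain ⟨s, hs⟩ := hm.exists_inv hk
  -- The two-sided multiplications extract from a nonzero class a scalar that is invertible modulo
  -- `m`.
  obtain ⟨S, hS⟩ := hT k
  have h1 : Ideal.Quotient.mk (h.ideal m) (h.coord d k • 1) ∈ I := by
    rw [hS, map_sum]
    exact sum_mem fun p _ => by
      rw [map_mul, map_mul]
      exact I.mul_mem_right _ _ (I.mul_mem_left _ _ hq)
  have h2 : (1 : h.order ⧸ h.ideal m) =
      Ideal.Quotient.mk _ (s • 1) * Ideal.Quotient.mk _ (h.coord d k • 1) := by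
    rw [← map_mul, ← map_one (Ideal.Quotient.mk (h.ideal m)), Ideal.Quotient.eq]
    have : (1 : h.order) - s • 1 * h.coord d k • 1 = (1 - s * h.coord d k) • (1 : h.order) := by
      rw [smul_mul_smul_comm, sub_smul, one_smul, one_mul]
    rw [this, h.smul_one_mem_ideal_iff hi]
    obtain ⟨z, hz, hz1⟩ := hs
    rw [← hz1]; simpa using hz
  exact I.one_mem_iff.1 (h2 ▸ I.mul_mem_left _ _ h1)

/-- A central class can be pulled out of the two-sided sum for the `i`-th coordinate, leaving it
multiplied by that coordinate of `1`, a unit. -/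
theorem IsIntegralBasis.exists_smul_one_of_mem_center_quotient {ι F D : Type*} [Fintype ι] [Field F]
    [Ring D] [Algebra F D] {b : Module.Basis ι F D} {R : Subring F} (h : IsIntegralBasis b R)
    {i : ι} (hi : IsUnit (h.coord 1 i))
    (hT : ∀ k, ∃ S : Finset (h.order × h.order), ∀ d : h.order,
      h.coord d k • (1 : h.order) = ∑ p ∈ S, p.1 * d * p.2)
    (m : Ideal R) {q : h.order ⧸ h.ideal m} (hq : ∀ z, q * z = z * q) :
    ∃ r : R, q = Ideal.Quotient.mk _ (r • 1) := by
  obtain ⟨d, rfl⟩ := Ideal.Quotient.mk_surjective q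
  obtain ⟨S, hS⟩ := hT i
  obtain ⟨α, hα⟩ := hi
  have h1 : Ideal.Quotient.mk (h.ideal m) (h.coord d i • 1) =
      Ideal.Quotient.mk _ (d * (α : R) • 1) := by
    rw [hα, hS d, hS 1, map_mul, map_sum, map_sum, Finset.mul_sum]
    refine Finset.sum_congr rfl fun p _ => ?_
    simp only [map_mul, mul_one, mul_assoc]
    rw [← mul_assoc, ← hq, mul_assoc]
  refine ⟨(↑α⁻¹ : R) * h.coord d i, ?_⟩
  have h2 : ∀ x y : h.order, Ideal.Quotient.mk (h.ideal m) x = Ideal.Quotient.mk _ y →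
      ∀ r : R, Ideal.Quotient.mk (h.ideal m) (r • x) = Ideal.Quotient.mk _ (r • y) := by
    intro x y hxy r
    rw [← one_mul x, ← one_mul y, ← smul_mul_assoc, ← smul_mul_assoc, map_mul, map_mul, hxy]
  have := h2 _ _ h1 (↑α⁻¹ : R)
  rw [mul_smul, this, mul_smul_comm, mul_one, smul_smul, Units.inv_mul, one_smul]

/-- In a finite field with an element `t` such that `t ^ 3 ≠ t` there are more than three
elements. -/
theorem FiniteField.three_lt_card_of_pow_three_ne {E : Type*} [Field E] [Finite E] {t : E}
    (ht : t ^ 3 ≠ t) : 3 < Cardinal.mk E := by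
  have := Fintype.ofFinite E
  rw [Cardinal.mk_fintype]
  by_contra hc
  have h3 : Fintype.card E ≤ 3 := by exact_mod_cast not_lt.1 hc
  have h1 : 1 < Fintype.card E := Fintype.one_lt_card
  have hp := FiniteField.pow_card t
  rcases (by omega : Fintype.card E = 2 ∨ Fintype.card E = 3) with h | h
  · rw [h] at hp
    exact ht (by rw [pow_succ, hp, ← sq, hp])
  · rw [h] at hp
    exact ht hp

/-- Modulo a maximal ideal of scalars, a noncentral unit of the order admits an idempotent of rank
one in general position. -/
theorem IsIntegralBasis.exists_rank_one_idempotent {ι F D : Type*} [Fintype ι] [Field F] [Ring D]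
    [Algebra F D] {b : Module.Basis ι F D} {R : Subring F} [Algebra.FiniteType ℤ R]
    (h : IsIntegralBasis b R) {i : ι} (hi : IsUnit (h.coord 1 i))
    (hT : ∀ k, ∃ S : Finset (h.order × h.order), ∀ d : h.order,
      h.coord d k • (1 : h.order) = ∑ p ∈ S, p.1 * d * p.2)
    {t : R} (ht : IsUnit (t ^ 3 - t)) {x x' y : h.order} (hx : x * x' = 1) (hx' : x' * x = 1)
    {k : ι} (hy : IsUnit (h.coord (x * y - y * x) k)) (m : Ideal R) [hm : m.IsMaximal] :
    ∃ e : h.order, e * e - e ∈ h.ideal m ∧ e ∉ h.ideal m ∧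
      (∀ z, ∃ r : R, e * z * e - r • e ∈ h.ideal m) ∧
      ∀ u, u = x ∨ u = x' → ∀ w, w = x ∨ w = x' →
        ∃ r : R, r ∉ m ∧ e * u * (1 - e) * w * e - r • e ∈ h.ideal m := by
  have := Ideal.finite_quotient_of_isMaximal_of_finiteType_int m
  have := h.isSimpleRing_quotient hi hT m
  obtain ⟨n, E, _, _, ⟨φ⟩⟩ :=
    IsSimpleRing.exists_ringEquiv_moduleEnd_of_finite (h.order ⧸ h.ideal m)
  let π : h.order →+* Module.End E (Fin n → E) :=
    (φ : _ →+* _).comp (Ideal.Quotient.mk (h.ideal m))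
  have hπs : Function.Surjective π := φ.surjective.comp Ideal.Quotient.mk_surjective
  have hπ0 : ∀ {z}, π z = 0 ↔ z ∈ h.ideal m := fun {z} => by
    simp [π, Ideal.Quotient.eq_zero_iff_mem]
  have hsmul : ∀ (r : R) (z : h.order), π (r • z) = π (r • 1) * π z := fun r z => by
    rw [← map_mul, smul_mul_assoc, one_mul]
  have hscal : ∀ c : E, ∃ r : R, π (r • 1) = c • 1 := by
    intro c
    obtain ⟨r, hr⟩ := h.exists_smul_one_of_mem_center_quotient hi hT m
      (q := φ.symm (c • 1)) (fun z => by
        apply φ.injective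
        simp)
    exact ⟨r, by
      change φ (Ideal.Quotient.mk _ (r • 1)) = _
      rw [← hr, φ.apply_symm_apply]⟩
  -- The image `c` of `t` in `E` satisfies `c ^ 3 ≠ c` because `t ^ 3 - t` is a unit of `R`.
  have hcard : 3 < Cardinal.mk E := by
    obtain ⟨c, hc⟩ := (Algebra.IsCentral.mem_center_iff E (x := π (t • 1))).1
      (Subalgebra.mem_center_iff.2 fun z => by
        obtain ⟨z, rfl⟩ := hπs z
        rw [← map_mul, ← map_mul]; simp)
    refine FiniteField.three_lt_card_of_pow_three_ne (t := c) fun h3 => ?_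
    have h4 : π ((t ^ 3 - t) • 1) = 0 := by
      have : (t ^ 3 - t) • (1 : h.order) = (t • 1) ^ 3 - t • 1 := by
        rw [smul_pow, one_pow, sub_smul]
      rw [this, map_sub, map_pow, hc, ← map_pow, h3, sub_self]
    rw [hπ0, h.smul_one_mem_ideal_iff hi] at h4
    exact hm.ne_top (m.eq_top_of_isUnit_mem h4 ht)
  obtain ⟨e, hee, he0, hrank, hprod⟩ := Module.End.exists_rank_one_idempotent hcard
    (X := π x) (Y := π x') (by rw [← map_mul, hx, map_one]) (by rw [← map_mul, hx', map_one])
    (fun hc => by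
      have : π (x * y - y * x) = 0 := by rw [map_sub, map_mul, map_mul, hc, sub_self]
      exact hm.ne_top (m.eq_top_of_isUnit_mem (hπ0.1 this k) hy))
  obtain ⟨e, rfl⟩ := hπs e
  refine ⟨e, hπ0.1 ?_, fun hm => he0 (hπ0.2 hm), fun z => ?_, fun u hu w hw => ?_⟩
  · rw [map_sub, map_mul, hee, sub_self]
  · obtain ⟨c, hc⟩ := hrank (π z)
    obtain ⟨r, hr⟩ := hscal c
    exact ⟨r, hπ0.1 (by rw [map_sub, hsmul, hr, map_mul, map_mul, hc, smul_one_mul, sub_self])⟩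
  · obtain ⟨c, hc0, hc⟩ := hprod (π u) (hu.imp (congrArg π) (congrArg π)) (π w)
      (hw.imp (congrArg π) (congrArg π))
    obtain ⟨r, hr⟩ := hscal c
    refine ⟨r, fun hrm => ?_, hπ0.1 ?_⟩
    · have h1 := hπ0.2 ((h.smul_one_mem_ideal_iff hi).2 hrm)
      rw [hr] at h1
      apply he0
      have : c • π e = 0 := by rw [← smul_one_mul, h1, zero_mul]
      exact (smul_eq_zero.1 this).resolve_left hc0
    · rw [map_sub, map_mul, map_mul, map_mul, map_mul, map_sub, map_one, hc, hsmul, hr,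
        smul_one_mul, sub_self]

/-! ### Choice of the coefficient ring and the valuation -/

theorem exists_pow_three_sub_ne_zero (F : Type*) [Field F] [Infinite F] :
    ∃ t : F, t ^ 3 - t ≠ 0 := by
  obtain ⟨t, ht⟩ := Polynomial.exists_eval_ne_zero_of_natDegree_lt_card
    (Polynomial.X ^ 3 - Polynomial.X : Polynomial F)
    (fun h => by simpa [Polynomial.coeff_X] using congrArg (Polynomial.coeff · 3) h)
    ((Cardinal.natCast_lt_aleph0).trans_le (Cardinal.aleph0_le_mk F))
  exact ⟨t, by simpa using ht⟩

/-- A finite-dimensional central division algebra has an integral basis over a finitely generated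
subring of the center which satisfies finitely many prescribed conditions. -/
theorem exists_integral_basis {F D : Type*} [Field F] [DivisionRing D] [Algebra F D]
    [FiniteDimensional F D] [Algebra.IsCentral F D] {T : Set D} (hT : T.Finite) {x y : D}
    (hxy : x * y ≠ y * x) :
    ∃ (n : ℕ) (b : Module.Basis (Fin n) F D) (R : Subring F) (_ : Algebra.FiniteType ℤ R)
      (h : IsIntegralBasis b R), T ⊆ h.order ∧ y ∈ h.order ∧
      (∀ i, (b.repr 1 i)⁻¹ ∈ R) ∧ (∀ i, (b.repr (x * y - y * x) i)⁻¹ ∈ R) ∧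
      (∃ t ∈ R, t ^ 3 - t ≠ 0 ∧ (t ^ 3 - t)⁻¹ ∈ R) ∧
      ∀ k, ∃ S : Finset (h.order × h.order), ∀ d : h.order,
        h.coord d k • (1 : h.order) = ∑ p ∈ S, p.1 * d * p.2 := by
  classical
  have : Infinite F := by
    by_contra hfin
    have : Finite F := not_infinite_iff_finite.1 hfin
    have : Finite D := Module.finite_of_finite F
    exact hxy ((littleWedderburn D).mul_comm x y)
  obtain ⟨t, ht⟩ := exists_pow_three_sub_ne_zero F
  let b := Module.finBasis F D
  choose S hS using fun k => ((b.coord k).smulRight (1 : D)).exists_eq_sum_mul_mul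
  let A : Set D := T ∪ {1, y} ∪ Set.range (fun p : Fin _ × Fin _ => b p.1 * b p.2) ∪
    ⋃ k, (Prod.fst '' (S k : Set (D × D)) ∪ Prod.snd '' (S k : Set (D × D)))
  have hA : A.Finite := ((hT.union (Set.toFinite _)).union (Set.finite_range _)).union
    (Set.finite_iUnion fun k => ((S k).finite_toSet.image _).union ((S k).finite_toSet.image _))
  -- All coordinates are inverted at once: a zero coordinate only contributes `0⁻¹ = 0`.
  let G : Set F := (⋃ d ∈ A, Set.range (b.repr d)) ∪ Set.range (fun i => (b.repr 1 i)⁻¹) ∪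
    Set.range (fun i => (b.repr (x * y - y * x) i)⁻¹) ∪ {t, (t ^ 3 - t)⁻¹}
  have hG : G.Finite := (((hA.biUnion fun d _ => Set.finite_range _).union
    (Set.finite_range _)).union (Set.finite_range _)).union (Set.toFinite _)
  have hAR : ∀ d ∈ A, ∀ k, b.repr d k ∈ Subring.closure G := fun d hd k =>
    Subring.subset_closure (.inl (.inl (.inl (Set.mem_biUnion hd ⟨k, rfl⟩))))
  have h : IsIntegralBasis b (Subring.closure G) :=
    ⟨hAR 1 (.inl (.inl (.inr (by simp)))), fun i j => hAR _ (.inl (.inr ⟨(i, j), rfl⟩))⟩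
  refine ⟨_, b, Subring.closure G, Subring.finiteType_int_closure hG, h,
    fun d hd => hAR d (.inl (.inl (.inl hd))), hAR y (.inl (.inl (.inr (by simp)))),
    fun i => Subring.subset_closure (.inl (.inl (.inr ⟨i, rfl⟩))),
    fun i => Subring.subset_closure (.inl (.inr ⟨i, rfl⟩)),
    ⟨t, Subring.subset_closure (.inr (by simp)), ht, Subring.subset_closure (.inr (by simp))⟩, ?_⟩
  intro k
  have hmem : ∀ p ∈ S k, p.1 ∈ h.order ∧ p.2 ∈ h.order := fun p hp =>
    ⟨hAR _ (.inr (Set.mem_iUnion.2 ⟨k, .inl ⟨p, hp, rfl⟩⟩)),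
      hAR _ (.inr (Set.mem_iUnion.2 ⟨k, .inr ⟨p, hp, rfl⟩⟩))⟩
  refine ⟨(S k).attach.map ⟨fun p => (⟨p.1.1, (hmem p.1 p.2).1⟩, ⟨p.1.2, (hmem p.1 p.2).2⟩),
    fun p q hpq => ?_⟩, fun d => Subtype.ext ?_⟩
  · exact Subtype.ext (Prod.ext (congrArg (fun z => (z.1 : D)) hpq)
      (congrArg (fun z => (z.2 : D)) hpq))
  · rw [Finset.sum_map]
    push_cast
    refine Eq.trans ?_ ((hS k d).trans (Finset.sum_attach (S k) fun p => p.1 * d * p.2).symm)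
    rfl

/-- Any finite subset of a finite-dimensional central division algebra is integral for some gauge
for which a given noncentral element has nonintegral iterated conjugates of every order. -/
theorem exists_gauge_one_lt_iterConj {F D : Type*} [Field F] [DivisionRing D] [Algebra F D]
    [FiniteDimensional F D] [Algebra.IsCentral F D] {T : Set D} (hT : T.Finite) {x y : D}
    (hxT : x ∈ T) (hxT' : x⁻¹ ∈ T) (hxy : x * y ≠ y * x) :
    ∃ (O : ValuationSubring F) (g : O.valuation.Gauge D), (∀ d ∈ T, g d ≤ 1) ∧
      ∃ c : D, c ≠ 0 ∧ ∀ N, 1 < g (iterConj x c (N + 1)) := by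
  obtain ⟨n, b, R, _, h, hTR, hyR, h1, h2, ⟨t, htR, ht, ht'⟩, hproj⟩ :=
    exists_integral_basis (F := F) hT hxy
  have hx0 : x ≠ 0 := by rintro rfl; simp at hxy
  have hex : ∀ d : D, d ≠ 0 → ∃ i, b.repr d i ≠ 0 := fun d hd => by
    by_contra! hc
    exact hd (b.ext_elem fun i => by simpa using hc i)
  have hunit : ∀ {r : R}, (r : F) ≠ 0 → (r : F)⁻¹ ∈ R → IsUnit r := fun {r} hr hr' =>
    IsUnit.of_mul_eq_one ⟨_, hr'⟩ (Subtype.ext (mul_inv_cancel₀ hr))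
  obtain ⟨i, hi⟩ := hex 1 one_ne_zero
  obtain ⟨k, hk⟩ := hex _ (sub_ne_zero.2 hxy)
  lift y to h.order using hyR
  obtain ⟨X, hX⟩ : ∃ X : h.order, (X : D) = x := ⟨⟨x, hTR hxT⟩, rfl⟩
  obtain ⟨X', hX'⟩ : ∃ X' : h.order, (X' : D) = x⁻¹ := ⟨⟨x⁻¹, hTR hxT'⟩, rfl⟩
  obtain ⟨m, hm⟩ := Ideal.exists_maximal R
  obtain ⟨e, hee, he, hrank, hprod⟩ := h.exists_rank_one_idempotent (i := i)
    (hunit hi (h1 i)) hproj (t := ⟨t, htR⟩) (hunit ht ht') (x := X) (x' := X') (y := y)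
    (Subtype.ext (by simp [hX, hX', hx0])) (Subtype.ext (by simp [hX, hX', hx0])) (k := k)
    (hunit (by simpa [IsIntegralBasis.coord, hX] using hk)
      (by simpa [IsIntegralBasis.coord, hX] using h2 k)) m
  -- A valuation ring centered at `m`: elements of `R` outside `m` get value one.
  obtain ⟨O, hRO, hmO⟩ := Ideal.image_subset_nonunits_valuationSubring m hm.ne_top
  have hv : ∀ r ∈ R, O.valuation r ≤ 1 := fun r hr => (O.valuation_le_one_iff r).2 (hRO hr)
  have hvm : ∀ r : R, r ∈ m → O.valuation r < 1 := fun r hr =>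
    (O.mem_nonunits_iff).1 (hmO ⟨r, hr, rfl⟩)
  have hvu : ∀ r : R, r ∉ m → O.valuation r = 1 := fun r hr => by
    obtain ⟨s, z, hz, hsz⟩ := hm.exists_inv hr
    refine le_antisymm (hv r r.2) (not_lt.1 fun hlt => ?_)
    have h3 : O.valuation ((s : F) * r + z) < 1 := by
      refine (O.valuation.map_add _ _).trans_lt (max_lt ?_ (hvm z hz))
      rw [map_mul]
      exact (mul_le_of_le_one_left' (hv s s.2)).trans_lt hlt
    have h4 : (s : F) * r + z = 1 := congrArg Subtype.val hsz
    rw [h4, map_one] at h3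
    exact h3.false
  obtain ⟨g, hg⟩ : ∃ g : O.valuation.Gauge D, g = Valuation.Gauge.ofBasis O.valuation b
    (fun k => hv _ (h.one k)) fun i j k => hv _ (h.mul i j k) := ⟨_, rfl⟩
  have hg1 : ∀ {d}, g d ≤ 1 ↔ ∀ k, O.valuation (b.repr d k) ≤ 1 := by
    rw [hg]; exact Valuation.Gauge.ofBasis_le_one_iff
  have hglt : ∀ {d}, g d < 1 ↔ ∀ k, O.valuation (b.repr d k) < 1 := by
    rw [hg]; exact Valuation.Gauge.ofBasis_lt_one_iff
  have hgR : ∀ d : h.order, g d ≤ 1 := fun d => hg1.2 fun k => hv _ (d.2 k)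
  have hgm : ∀ d ∈ h.ideal m, g d < 1 := fun d hd => hglt.2 fun k => hvm _ (hd k)
  have hb : ∀ j, b j ∈ h.order := fun j k => by
    rw [b.repr_self, Finsupp.single_apply]
    split_ifs
    · exact R.one_mem
    · exact R.zero_mem
  refine ⟨O, g, fun d hd => hgR ⟨d, hTR hd⟩, 1 - e,
    g.one_lt_iterConj (hX ▸ hgR X) (hX' ▸ hgR X') (hgR e) ?_ (hgm _ hee) ?_ ?_⟩
  · refine fun hlt => he fun k => ?_
    by_contra hc
    exact (hglt.1 hlt k).ne (hvu _ hc)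
  · intro z hz
    -- `z` has coordinates in `O`, not necessarily in `R`, so the rank-one relation is extended
    -- linearly from the basis.
    choose r hr using fun j => hrank ⟨b j, hb j⟩
    refine ⟨∑ j, b.repr z j * r j, ?_⟩
    have hz' : (e : D) * z * e = ∑ j, b.repr z j • ((e : D) * b j * e) := by
      conv_lhs => rw [← b.sum_repr z]
      rw [Finset.mul_sum, Finset.sum_mul]
      simp only [mul_smul_comm, smul_mul_assoc]
    have hsum : (e : D) * z * e - (∑ j, b.repr z j * (r j : F)) • (e : D) =
        ∑ j, b.repr z j • ((e : D) * b j * e - (r j : F) • (e : D)) := by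
      simp only [hz', Finset.sum_smul, smul_sub, mul_smul, Finset.sum_sub_distrib]
    rw [Valuation.Gauge.Congr, hsum]
    refine Finset.sum_induction _ (fun d => g d < 1)
      (fun a c ha hc => (g.add_le' a c).trans_lt (max_lt ha hc))
      (by rw [g.map_zero]; exact zero_lt_one) fun j _ => ?_
    rw [g.smul']
    exact (mul_le_of_le_one_left' (hg1.1 hz j)).trans_lt (hgm _ (hr j))
  · have hlift : ∀ u, u = x ∨ u = x⁻¹ → ∃ u' : h.order, (u' : D) = u ∧ (u' = X ∨ u' = X') := by
      rintro u (rfl | rfl)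
      · exact ⟨X, hX, .inl rfl⟩
      · exact ⟨X', hX', .inr rfl⟩
    intro u hu w hw
    obtain ⟨u', rfl, hu'⟩ := hlift u hu
    obtain ⟨w', rfl, hw'⟩ := hlift w hw
    obtain ⟨r, hrm, hr⟩ := hprod u' hu' w' hw'
    exact ⟨r, hvu r hrm, hgm _ hr⟩

/-! ### Conclusion -/

/-- In a noncommutative division ring of finite dimension over its center, a finitely
generated group of units does not contain all iterated conjugates of a noncentral element. -/
theorem exists_iterConj_notMem_closure (F : Type*) {D : Type*} [Field F] [DivisionRing D]
    [Algebra F D] [FiniteDimensional F D] [Algebra.IsCentral F D] {S : Set Dˣ} (hS : S.Finite)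
    {x : Dˣ} {y : D} (hxy : x * y ≠ y * x) (N : ℕ) :
    ∃ c : Dˣ, iterConj x c (N + 1) ∉ Subgroup.closure S := by
  let T : Set D := (fun u : Dˣ => (u : D)) '' (S ∪ {x}) ∪ (fun u : Dˣ => (u : D)⁻¹) '' (S ∪ {x})
  have hT : T.Finite := ((hS.union (Set.finite_singleton x)).image _).union
    ((hS.union (Set.finite_singleton x)).image _)
  obtain ⟨O, g, hgT, c, hc0, hc⟩ := exists_gauge_one_lt_iterConj (F := F) hT
    (.inl ⟨x, by simp, rfl⟩) (.inr ⟨x, by simp, rfl⟩) hxy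
  refine ⟨Units.mk0 c hc0, fun hmem => ?_⟩
  have hN : ∀ u ∈ Subgroup.closure S, g (u : D) ≤ 1 ∧ g (u : D)⁻¹ ≤ 1 := by
    intro u hu
    induction hu using Subgroup.closure_induction with
    | mem u hu => exact ⟨hgT _ (.inl ⟨u, .inl hu, rfl⟩), hgT _ (.inr ⟨u, .inl hu, rfl⟩)⟩
    | one => simpa using g.one_le'
    | mul u w _ _ hu hw =>
      rw [Units.val_mul, mul_inv_rev]
      exact ⟨g.mul_le_one hu.1 hw.1, g.mul_le_one hw.2 hu.2⟩
    | inv u _ hu => rw [Units.val_inv_eq_inv_val, inv_inv]; exact ⟨hu.2, hu.1⟩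
  have := (hN _ hmem).1
  rw [Units.val_iterConj] at this
  exact (hc N).not_ge this

theorem theorem9p1 {D : Type*} [DivisionRing D] (hD : IsWeaklyLocallyFinite D)
    (N : Subgroup Dˣ) (hfg : N.FG) (hN : N.IsSubnormal) :
    ∀ x ∈ N, (x : D) ∈ Subring.center D := by
  intro x hx
  refine Subring.mem_center_iff.2 fun y => ?_
  by_contra hxy
  obtain ⟨n, hn⟩ := hN.exists_iterConj_mem
  obtain ⟨S, hS⟩ := hfg
  -- Including `y` keeps `x` noncentral in `K`.
  let T : Set D := (fun u : Dˣ => (u : D)) '' (S ∪ {x}) ∪ {y}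
  have hT : T.Finite := ((S.finite_toSet.union (Set.finite_singleton x)).image _).union
    (Set.finite_singleton y)
  let K := Subfield.closure T
  have hTK : ∀ d ∈ T, d ∈ K := fun d hd => Subfield.subset_closure hd
  have : Module.Finite (Subring.center K) K := hD T hT
  have : Algebra.IsCentral (Subring.center K) K := ⟨fun z hz =>
    Algebra.mem_bot.2 ⟨⟨z, Subring.mem_center_iff.2 (Subalgebra.mem_center_iff.1 hz)⟩, rfl⟩⟩
  let f : Kˣ →* Dˣ := Units.map (K.subtype : K →* D)
  have hf : Function.Injective f := Units.map_injective K.subtype_injective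
  have hrange : ∀ u : Dˣ, (u : D) ∈ K → ∃ w : Kˣ, f w = u := fun u hu =>
    ⟨Units.mk0 ⟨u, hu⟩ fun h => u.ne_zero (congrArg Subtype.val h), Units.ext rfl⟩
  obtain ⟨z, hz⟩ := hrange x (hTK _ (.inl ⟨x, by simp, rfl⟩))
  have hNf : N = (Subgroup.closure (f ⁻¹' S)).map f := by
    rw [MonoidHom.map_closure, Set.image_preimage_eq_of_subset, hS]
    exact fun u hu => hrange u (hTK _ (.inl ⟨u, .inl hu, rfl⟩))
  obtain ⟨c, hc⟩ := exists_iterConj_notMem_closure (Subring.center K)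
    (S.finite_toSet.preimage hf.injOn) (x := z) (y := ⟨y, hTK _ (.inr rfl)⟩)
    (fun h => hxy (by rw [← hz]; exact (congrArg Subtype.val h).symm)) n
  have hmem := hn x hx (f c)
  rw [← hz, ← map_iterConj, hNf] at hmem
  obtain ⟨w, hw, hwc⟩ := hmem
  exact hc (hf hwc ▸ hw)
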